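/- Identify $\mathbb{R}^4$ with $\mathbb{C}^2$ with its standard symplectic form $\omega_0=dx_1\wedge dy_1+dx_2\wedge dy_2$. For $U,V\subset\mathbb{R}^4$ write $U\hookrightarrow V$ if there is a symplectomorphism $\phi$ of $\mathbb{R}^4$ (a smooth diffeomorphism of $\mathbb{R}^4$ with $\phi^*\omega_0=\omega_0$) such that $\phi(U)\subset V$, and define the coarse symplectic Banach–Mazur distance $$d_c(U,V)=\inf\left\{\log\lambda\ge 0\;\middle|\;\tfrac1\lambda U\hookrightarrow V\hookrightarrow\lambda U\right\}\in[0,+\infty],\qquad \inf\emptyset=+\infty,$$ where $\lambda U=\{\lambda z\mid z\in U\}$. Let $\mathcal{C}_4$ be the collection of symplectically convex domains, that is, of the images $\phi(K)$ of compact convex sets $K\subset\mathbb{R}^4$ with non-empty interior under symplectomorphisms $\phi$ of $\mathbb{R}^4$, and put $d_c(U,\mathcal{C}_4)=\inf_{V\in\mathcal{C}_4}d_c(U,V)$. For $p\in(0,1]$ let $\Omega_p^{\mathrm{lin}}\subset[0,\infty)^2$ be the closed region bounded by the coordinate axes and the broken line from $(1,0)$ through $(2^{-1/p},2^{-1/p})$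 to $(0,1)$, i.e. the region obtained from $\{(x,y)\in[0,\infty)^2\mid x^p+y^p\le1\}$ by replacing each half of the curve $x^p+y^p=1$ (cut at the diagonal) by its chord; and let $$X_{\Omega_p^{\mathrm{lin}}}=\left\{(z_1,z_2)\in\mathbb{C}^2\;\middle|\;(\pi|z_1|^2,\pi|z_2|^2)\in\Omega_p^{\mathrm{lin}}\right\}.$$ Proposition. For every $p\in(0,1]$, $$d_c\left(X_{\Omega_p^{\mathrm{lin}}},\mathcal{C}_4\right)\le\tfrac12\log 3 .$$ -/

import Mathlib

open scoped Pointwise ContDiff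

noncomputable section

namespace CoarseToric

/-- The standard symplectic form `dx₁ ∧ dy₁ + dx₂ ∧ dy₂` on `ℂ² = ℝ⁴`, with `z_j = x_j + i y_j`. -/
def omega (v w : ℂ × ℂ) : ℝ :=
  (v.1.re * w.1.im - v.1.im * w.1.re) + (v.2.re * w.2.im - v.2.im * w.2.re)

/-- `φ` is a symplectomorphism of `ℝ⁴`: a smooth diffeomorphism of the whole space whose
differential preserves the standard symplectic form at every point. -/
structure IsSymplectomorphism (φ : (ℂ × ℂ) ≃ (ℂ × ℂ)) : Prop where
  contDiff : ContDiff ℝ ∞ φ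
  contDiff_symm : ContDiff ℝ ∞ φ.symm
  preserves : ∀ z v w : ℂ × ℂ, omega (fderiv ℝ φ z v) (fderiv ℝ φ z w) = omega v w

/-- `U ↪ V`: some symplectomorphism of `ℝ⁴` maps `U` into `V`. -/
def SymplEmbeds (U V : Set (ℂ × ℂ)) : Prop :=
  ∃ φ : (ℂ × ℂ) ≃ (ℂ × ℂ), IsSymplectomorphism φ ∧ φ '' U ⊆ V

/-- The coarse symplectic Banach-Mazur distance
`d_c(U, V) = inf {log l ≥ 0 | (1/l) U ↪ V ↪ l U}`, where `l U` is the dilation of `U` in `ℝ⁴`.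
It is extended-real valued, so that the infimum of the empty set is `+∞`. -/
def coarseDist (U V : Set (ℂ × ℂ)) : EReal :=
  sInf {d : EReal | ∃ l : ℝ, 1 ≤ l ∧
    SymplEmbeds (l⁻¹ • U) V ∧ SymplEmbeds V (l • U) ∧ d = (Real.log l : EReal)}

/-- The distance `d_c(U, 𝓑) = inf_{V ∈ 𝓑} d_c(U, V)` from a set to a collection of sets. -/
def coarseDistTo (U : Set (ℂ × ℂ)) (B : Set (Set (ℂ × ℂ))) : EReal :=
  ⨅ V ∈ B, coarseDist U V

/-- A convex domain of `ℝ⁴`: a compact convex set with non-empty interior. -/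
def IsConvexDomain (K : Set (ℂ × ℂ)) : Prop :=
  Convex ℝ K ∧ IsCompact K ∧ (interior K).Nonempty

/-- The collection `𝓒₄` of symplectically convex domains: the images of the convex domains under
the symplectomorphisms of `ℝ⁴`. -/
def symplConvexDomains : Set (Set (ℂ × ℂ)) :=
  {V | ∃ K : Set (ℂ × ℂ), IsConvexDomain K ∧
    ∃ φ : (ℂ × ℂ) ≃ (ℂ × ℂ), IsSymplectomorphism φ ∧ φ '' K = V}

/-- The standard moment map `(z₁, z₂) ↦ (π |z₁|², π |z₂|²)`. -/
def momentMap (z : ℂ × ℂ) : ℝ × ℝ :=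
  (Real.pi * ‖z.1‖ ^ 2, Real.pi * ‖z.2‖ ^ 2)

/-- The toric domain `X_Ω = μ⁻¹(Ω)`. -/
def toricDomain (Ω : Set (ℝ × ℝ)) : Set (ℂ × ℂ) :=
  momentMap ⁻¹' Ω

/-- The coordinate `2 ^ (-1/p)` of the point at which the curve `x ^ p + y ^ p = 1` meets the
diagonal `x = y`. -/
def diagCoord (p : ℝ) : ℝ := (2 : ℝ) ^ (-(1 / p))

/-- The piecewise linear region `Ω_p^lin`: the curve `x ^ p + y ^ p = 1` in the first quadrant is
replaced by the broken line through `(1, 0)`, `(m, m)`, `(0, 1)`, where `m = 2 ^ (-1/p)`.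
The region between the axes and the broken line is the quadrilateral with vertices
`(0, 0)`, `(1, 0)`, `(m, m)`, `(0, 1)`, written as the union of two triangles. -/
def linearRegion (p : ℝ) : Set (ℝ × ℝ) :=
  convexHull ℝ {((0 : ℝ), (0 : ℝ)), (1, 0), (diagCoord p, diagCoord p)} ∪
    convexHull ℝ {((0 : ℝ), (0 : ℝ)), (0, 1), (diagCoord p, diagCoord p)}

end CoarseToric

end

noncomputable section

namespace CoarseToric

/-! ### Symplectomorphisms: groupoid properties -/

/-! Put `m = 2 ^ (-1/p) ≤ 1/2` and `c = m / (1 - m) ≤ 1`, and let `E(a, b)` be the ellipsoid whose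
moment image is the triangle with vertices `(0, 0)`, `(a, 0)`, `(0, b)`. The two halves of the
broken line lie on the hypotenuses of `E(1, c)` and `E(c, 1)`, so the toric domain `X` contains
`E(1, c)` and lies in `E(1, c) ∪ E(c, 1)`. The comparison domain is the convex set `V = E(3, 3c) =
√3 E(1, c)`. Then `V ⊆ √3 X` is an inclusion, and what has to be found is a symplectomorphism
carrying `X` into `3 E(1, c)`.

After rescaling, `X` lies in the union of two thin neighbourhoods of the coordinate axes, `c |z₁|² +
|z₂|² ≤ 1` and `|z₁|² + c |z₂|² ≤ 1`, and the target is `c |w₁|² + |w₂|² ≤ 9`. The second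
neighbourhood must be laid alongside the first. `tilt` separates the two outside the ball `|z|² ≤ 8`
by the sign of `Re (z₁ conj z₂)`; `partialSwap` then fixes the positive side and exchanges the
coordinates on the negative side. Both maps preserve `|z|²`, so `c |w₁|² ≤ c |z|² ≤ 1`, while `|w₂|²
≤ 8` holds inside the ball trivially and outside it by the estimates `tilt_near_fst` and
`tilt_near_snd`.

Both maps come from explicit Hamiltonian flows: the Hamiltonians depend only on `|z|²` and `Re (z₁
conj z₂)`, which `hadamard` turns into functions of the moduli, and such flows are twists. -/

theorem IsSymplectomorphism.refl : IsSymplectomorphism (Equiv.refl (ℂ × ℂ)) where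
  contDiff := contDiff_id
  contDiff_symm := contDiff_id
  preserves z v w := by
    have h : fderiv ℝ (⇑(Equiv.refl (ℂ × ℂ))) z = ContinuousLinearMap.id ℝ (ℂ × ℂ) := fderiv_id
    rw [h]; rfl

theorem IsSymplectomorphism.trans {φ ψ : (ℂ × ℂ) ≃ (ℂ × ℂ)} (hφ : IsSymplectomorphism φ)
    (hψ : IsSymplectomorphism ψ) : IsSymplectomorphism (φ.trans ψ) where
  contDiff := hψ.contDiff.comp hφ.contDiff
  contDiff_symm := hφ.contDiff_symm.comp hψ.contDiff_symm
  preserves z v w := by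
    have h : fderiv ℝ (⇑(φ.trans ψ)) z = (fderiv ℝ ψ (φ z)).comp (fderiv ℝ φ z) :=
      fderiv_comp z (hψ.contDiff.differentiable (by simp) _)
        (hφ.contDiff.differentiable (by simp) _)
    rw [h, ContinuousLinearMap.comp_apply, ContinuousLinearMap.comp_apply, hψ.preserves,
      hφ.preserves]

/-- Conjugation of a bijection of `ℂ²` by the homothety of ratio `r`. -/
def conjHomothety (r : ℝ) (hr : r ≠ 0) (φ : (ℂ × ℂ) ≃ (ℂ × ℂ)) : (ℂ × ℂ) ≃ (ℂ × ℂ) where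
  toFun z := r⁻¹ • φ (r • z)
  invFun z := r⁻¹ • φ.symm (r • z)
  left_inv z := by simp [smul_smul, hr]
  right_inv z := by simp [smul_smul, hr]

theorem IsSymplectomorphism.conjHomothety {r : ℝ} (hr : r ≠ 0) {φ : (ℂ × ℂ) ≃ (ℂ × ℂ)}
    (hφ : IsSymplectomorphism φ) : IsSymplectomorphism (conjHomothety r hr φ) where
  contDiff := contDiff_const.smul (hφ.contDiff.comp (contDiff_const_smul r))
  contDiff_symm := contDiff_const.smul (hφ.contDiff_symm.comp (contDiff_const_smul r))
  preserves z v w := by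
    have hs : HasFDerivAt (fun z : ℂ × ℂ => r • z) (r • ContinuousLinearMap.id ℝ (ℂ × ℂ)) z :=
      (hasFDerivAt_id z).const_smul r
    have hd := (hφ.contDiff.differentiable (by simp) (r • z)).hasFDerivAt
    have h := ((hd.comp z hs).const_smul r⁻¹).fderiv
    have h' : ∀ u, fderiv ℝ (CoarseToric.conjHomothety r hr φ) z u = fderiv ℝ φ (r • z) u := by
      intro u
      have : fderiv ℝ (CoarseToric.conjHomothety r hr φ) z = _ := h
      rw [this]
      simp [smul_smul, hr]
    rw [h', h', hφ.preserves]

/-! ### The unitary involution -/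

/-- The unitary involution `(z₁, z₂) ↦ ((z₁ + z₂) / √2, (z₁ - z₂) / √2)`. -/
def hadamard : (ℂ × ℂ) ≃ (ℂ × ℂ) where
  toFun z := ((√2 : ℝ)⁻¹ • (z.1 + z.2), (√2 : ℝ)⁻¹ • (z.1 - z.2))
  invFun z := ((√2 : ℝ)⁻¹ • (z.1 + z.2), (√2 : ℝ)⁻¹ • (z.1 - z.2))
  left_inv z := by
    have h : (√2 : ℝ)⁻¹ * (√2 : ℝ)⁻¹ = 1 / 2 := by rw [← mul_inv]; norm_num
    ext1
    · simp only [← smul_add, smul_smul, h]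
      rw [add_add_sub_cancel, ← two_smul ℝ, smul_smul]; norm_num
    · simp only [← smul_sub, smul_smul, h]
      rw [add_sub_sub_cancel, ← two_smul ℝ, smul_smul]; norm_num
  right_inv z := by
    have h : (√2 : ℝ)⁻¹ * (√2 : ℝ)⁻¹ = 1 / 2 := by rw [← mul_inv]; norm_num
    ext1
    · simp only [← smul_add, smul_smul, h]
      rw [add_add_sub_cancel, ← two_smul ℝ, smul_smul]; norm_num
    · simp only [← smul_sub, smul_smul, h]
      rw [add_sub_sub_cancel, ← two_smul ℝ, smul_smul]; norm_num

theorem hadamard_apply (z : ℂ × ℂ) :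
    hadamard z = ((√2 : ℝ)⁻¹ • (z.1 + z.2), (√2 : ℝ)⁻¹ • (z.1 - z.2)) := rfl

theorem hadamard_isSymplectomorphism : IsSymplectomorphism hadamard := by
  let L : (ℂ × ℂ) →L[ℝ] (ℂ × ℂ) :=
    ((√2 : ℝ)⁻¹ • (ContinuousLinearMap.fst ℝ ℂ ℂ + ContinuousLinearMap.snd ℝ ℂ ℂ)).prod
      ((√2 : ℝ)⁻¹ • (ContinuousLinearMap.fst ℝ ℂ ℂ - ContinuousLinearMap.snd ℝ ℂ ℂ))
  have hL : ⇑hadamard = ⇑L := rfl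
  have hL' : ⇑hadamard.symm = ⇑L := rfl
  refine ⟨hL ▸ L.contDiff, hL' ▸ L.contDiff, fun z v w => ?_⟩
  rw [hL, L.fderiv, ← hL, hadamard_apply, hadamard_apply]
  have h : (√2 : ℝ)⁻¹ * (√2 : ℝ)⁻¹ = 1 / 2 := by rw [← mul_inv]; norm_num
  simp only [omega, Complex.smul_re, Complex.smul_im, Complex.add_re, Complex.add_im,
    Complex.sub_re, Complex.sub_im, smul_eq_mul]
  linear_combination (2 * (v.1.re * w.1.im - v.1.im * w.1.re) +
    2 * (v.2.re * w.2.im - v.2.im * w.2.re)) * h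

theorem sq_norm_eq (w : ℂ) : ‖w‖ ^ 2 = w.re ^ 2 + w.im ^ 2 := by
  rw [Complex.sq_norm, Complex.normSq_apply]; ring

/-- The difference of this and its companion is `2 Re (z₁ conj z₂)`: this is how the height becomes
a function of the moduli. -/
theorem hadamard_sq_norm_fst (z : ℂ × ℂ) :
    ‖(hadamard z).1‖ ^ 2 =
      (‖z.1‖ ^ 2 + ‖z.2‖ ^ 2) / 2 + (z.1.re * z.2.re + z.1.im * z.2.im) := by
  have h : (√2 : ℝ)⁻¹ * (√2 : ℝ)⁻¹ = 1 / 2 := by rw [← mul_inv]; norm_num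
  simp only [hadamard_apply, sq_norm_eq, Complex.smul_re, Complex.smul_im, Complex.add_re,
    Complex.add_im, smul_eq_mul]
  linear_combination ((z.1.re + z.2.re) ^ 2 + (z.1.im + z.2.im) ^ 2) * h

theorem hadamard_sq_norm_snd (z : ℂ × ℂ) :
    ‖(hadamard z).2‖ ^ 2 =
      (‖z.1‖ ^ 2 + ‖z.2‖ ^ 2) / 2 - (z.1.re * z.2.re + z.1.im * z.2.im) := by
  have h : (√2 : ℝ)⁻¹ * (√2 : ℝ)⁻¹ = 1 / 2 := by rw [← mul_inv]; norm_num
  simp only [hadamard_apply, sq_norm_eq, Complex.smul_re, Complex.smul_im, Complex.sub_re,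
    Complex.sub_im, smul_eq_mul]
  linear_combination ((z.1.re - z.2.re) ^ 2 + (z.1.im - z.2.im) ^ 2) * h

/-- Unitary maps that are diagonal in the frame of `hadamard`. -/
theorem hadamard_diag_hadamard (a b : ℂ) (z : ℂ × ℂ) :
    hadamard (a * (hadamard z).1, b * (hadamard z).2) =
      ((a + b) / 2 * z.1 + (a - b) / 2 * z.2, (a - b) / 2 * z.1 + (a + b) / 2 * z.2) := by
  have h : ((√2 : ℝ) : ℂ)⁻¹ * ((√2 : ℝ) : ℂ)⁻¹ = 1 / 2 := by
    rw [← Complex.ofReal_inv, ← Complex.ofReal_mul, ← mul_inv]; norm_num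
  simp only [hadamard_apply, Complex.real_smul, Complex.ofReal_inv]
  ext1
  · linear_combination (a * (z.1 + z.2) + b * (z.1 - z.2)) * h
  · linear_combination (a * (z.1 + z.2) - b * (z.1 - z.2)) * h

/-! ### Twist maps of the toric fibration -/

/-- The squared moduli of the coordinates. -/
def sqNorms (z : ℂ × ℂ) : ℝ × ℝ := (‖z.1‖ ^ 2, ‖z.2‖ ^ 2)

theorem norm_exp_mul (t : ℝ) (w : ℂ) : ‖Complex.exp (t * Complex.I) * w‖ = ‖w‖ := by
  rw [norm_mul, Complex.norm_exp_ofReal_mul_I, one_mul]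

/-- The map rotating the coordinates by angles that depend on their moduli. -/
def twist (f g : ℝ × ℝ → ℝ) : (ℂ × ℂ) ≃ (ℂ × ℂ) where
  toFun z := (Complex.exp (f (sqNorms z) * Complex.I) * z.1,
    Complex.exp (g (sqNorms z) * Complex.I) * z.2)
  invFun z := (Complex.exp ((-f (sqNorms z) : ℝ) * Complex.I) * z.1,
    Complex.exp ((-g (sqNorms z) : ℝ) * Complex.I) * z.2)
  left_inv z := by
    simp only [sqNorms, norm_exp_mul, ← mul_assoc, ← Complex.exp_add, ← add_mul,
      ← Complex.ofReal_add]
    simp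
  right_inv z := by
    simp only [sqNorms, norm_exp_mul, ← mul_assoc, ← Complex.exp_add, ← add_mul,
      ← Complex.ofReal_add]
    simp

theorem twist_apply (f g : ℝ × ℝ → ℝ) (z : ℂ × ℂ) :
    twist f g z = (Complex.exp (f (sqNorms z) * Complex.I) * z.1,
      Complex.exp (g (sqNorms z) * Complex.I) * z.2) := rfl

theorem contDiff_sqNorms : ContDiff ℝ ∞ sqNorms :=
  (contDiff_fst.norm_sq ℝ).prodMk (contDiff_snd.norm_sq ℝ)

theorem contDiff_rotate {f : ℝ × ℝ → ℝ} (hf : ContDiff ℝ ∞ f) {k : ℂ × ℂ → ℂ}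
    (hk : ContDiff ℝ ∞ k) :
    ContDiff ℝ ∞ fun z : ℂ × ℂ => Complex.exp (f (sqNorms z) * Complex.I) * k z :=
  ((((Complex.ofRealCLM.contDiff.comp (hf.comp contDiff_sqNorms)).mul contDiff_const).cexp)).mul hk

theorem hasFDerivAt_sqNorms (z : ℂ × ℂ) :
    ∃ L : (ℂ × ℂ) →L[ℝ] (ℝ × ℝ), HasFDerivAt sqNorms L z ∧ ∀ v,
      L v = (2 * (z.1.re * v.1.re + z.1.im * v.1.im), 2 * (z.2.re * v.2.re + z.2.im * v.2.im)) := by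
  refine ⟨_, (hasFDerivAt_fst.norm_sq).prodMk (hasFDerivAt_snd.norm_sq), fun v => ?_⟩
  ext1 <;> simp [Complex.inner, two_mul] <;> ring

theorem apply_pair (L : (ℝ × ℝ) →L[ℝ] ℝ) (a b : ℝ) : L (a, b) = a * L (1, 0) + b * L (0, 1) := by
  have : ((a, b) : ℝ × ℝ) = a • (1, 0) + b • (0, 1) := by simp
  rw [this, map_add, map_smul, map_smul]; rfl

theorem area_rotate (t : ℝ) (v w : ℂ) :
    (Complex.exp (t * Complex.I) * v).re * (Complex.exp (t * Complex.I) * w).im -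
      (Complex.exp (t * Complex.I) * v).im * (Complex.exp (t * Complex.I) * w).re =
    v.re * w.im - v.im * w.re := by
  simp only [Complex.mul_re, Complex.mul_im, Complex.exp_ofReal_mul_I_re,
    Complex.exp_ofReal_mul_I_im]
  linear_combination (v.re * w.im - v.im * w.re) * Real.sin_sq_add_cos_sq t

theorem hasFDerivAt_rotate {a : ℂ × ℂ → ℝ} {a' : (ℂ × ℂ) →L[ℝ] ℝ} {z : ℂ × ℂ}
    (ha : HasFDerivAt a a' z) (k : (ℂ × ℂ) →L[ℝ] ℂ) :
    ∃ L : (ℂ × ℂ) →L[ℝ] ℂ, HasFDerivAt (fun z => Complex.exp (a z * Complex.I) * k z) L z ∧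
      ∀ v, L v = Complex.exp (a z * Complex.I) * (k v + a' v * Complex.I * k z) := by
  have h1 : HasFDerivAt (fun z => (a z : ℂ)) (Complex.ofRealCLM.comp a') z :=
    Complex.ofRealCLM.hasFDerivAt.comp z ha
  refine ⟨_, ((h1.mul_const Complex.I).cexp).mul k.hasFDerivAt, fun v => ?_⟩
  simp
  ring

/-- A twist map is symplectic when its angles `f`, `g` satisfy the closedness condition
`∂f/∂t = ∂g/∂s`. -/
theorem twist_isSymplectomorphism {f g : ℝ × ℝ → ℝ} (hf : ContDiff ℝ ∞ f) (hg : ContDiff ℝ ∞ g)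
    (hfg : ∀ s t, ∃ d, HasDerivAt (fun t' => f (s, t')) d t ∧
      HasDerivAt (fun s' => g (s', t)) d s) :
    IsSymplectomorphism (twist f g) where
  contDiff := (contDiff_rotate hf contDiff_fst).prodMk (contDiff_rotate hg contDiff_snd)
  contDiff_symm :=
    (contDiff_rotate hf.neg contDiff_fst).prodMk (contDiff_rotate hg.neg contDiff_snd)
  preserves z v w := by
    obtain ⟨L, hL, hLv⟩ := hasFDerivAt_sqNorms z
    have hf' := (hf.differentiable (by simp) (sqNorms z)).hasFDerivAt
    have hg' := (hg.differentiable (by simp) (sqNorms z)).hasFDerivAt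
    obtain ⟨d, hd1, hd2⟩ := hfg (sqNorms z).1 (sqNorms z).2
    have e1 : fderiv ℝ f (sqNorms z) (0, 1) = d := by
      refine HasDerivAt.unique ?_ hd1
      exact hf'.comp_hasDerivAt (sqNorms z).2
        ((hasDerivAt_const (sqNorms z).2 (sqNorms z).1).prodMk (hasDerivAt_id _))
    have e2 : fderiv ℝ g (sqNorms z) (1, 0) = d := by
      refine HasDerivAt.unique ?_ hd2
      exact hg'.comp_hasDerivAt (sqNorms z).1
        ((hasDerivAt_id _).prodMk (hasDerivAt_const (sqNorms z).1 (sqNorms z).2))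
    obtain ⟨P, hP, hPv⟩ := hasFDerivAt_rotate (hf'.comp z hL) (ContinuousLinearMap.fst ℝ ℂ ℂ)
    obtain ⟨Q, hQ, hQv⟩ := hasFDerivAt_rotate (hg'.comp z hL) (ContinuousLinearMap.snd ℝ ℂ ℂ)
    have h : fderiv ℝ (twist f g) z = P.prod Q := (hP.prodMk hQ).fderiv
    simp only [h, omega, ContinuousLinearMap.prod_apply, hPv, hQv, area_rotate,
      ContinuousLinearMap.comp_apply, hLv, ContinuousLinearMap.coe_fst',
      ContinuousLinearMap.coe_snd']
    simp only [apply_pair _ (2 * _) (2 * _), e1, e2, Complex.add_re, Complex.add_im,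
      Complex.mul_re, Complex.mul_im, Complex.ofReal_re, Complex.ofReal_im, Complex.I_re,
      Complex.I_im]
    ring

/-! ### Tilting the two ellipsoids -/

/-- The tilting angle on the sphere `|z₁|² + |z₂|² = x`, equivalent to `3 / (2 √x)`. -/
def tiltAngle (x : ℝ) : ℝ := 3 / 2 / √(√(1 + x ^ 2))

/-- The nested root in place of `√x` is what gives smoothness at `x = 0`. -/
theorem contDiff_tiltAngle : ContDiff ℝ ∞ tiltAngle := by
  have h : ∀ x : ℝ, 0 < 1 + x ^ 2 := fun x => by positivity
  refine contDiff_const.div (ContDiff.sqrt (ContDiff.sqrt ?_ fun x => (h x).ne') fun x =>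
    (Real.sqrt_pos.2 (h x)).ne') fun x => (Real.sqrt_pos.2 (Real.sqrt_pos.2 (h x))).ne'
  exact contDiff_const.add (contDiff_id.pow 2)

theorem tiltAngle_bounds {x : ℝ} (hx : 8 ≤ x) :
    0 < tiltAngle x ∧ tiltAngle x ^ 2 * x ≤ 9 / 4 ∧ 9 / 4 ≤ tiltAngle x ^ 2 * (x + 1) := by
  have h0 : (0 : ℝ) < √(1 + x ^ 2) := Real.sqrt_pos.2 (by positivity)
  have h1 : x ≤ √(1 + x ^ 2) := Real.le_sqrt_of_sq_le (by linarith)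
  have h2 : √(1 + x ^ 2) ≤ x + 1 := Real.sqrt_le_iff.2 ⟨by linarith, by nlinarith⟩
  have h3 : tiltAngle x ^ 2 = 9 / 4 / √(1 + x ^ 2) := by
    rw [tiltAngle, div_pow, Real.sq_sqrt h0.le]; norm_num
  refine ⟨div_pos (by norm_num) (Real.sqrt_pos.2 h0), ?_, ?_⟩
  · rw [h3, div_mul_eq_mul_div, div_le_iff₀ h0]; linarith
  · rw [h3, div_mul_eq_mul_div, le_div_iff₀ h0]; linarith

/-- Here `a` is the modulus of the long coordinate and the other has modulus at most `1`. A tilt by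
about `3 / (2a)` displaces the axis by about `3/2`, more than the thickness `1` of its
neighbourhood. The bound `x ≥ 8` gives `α² ≤ 9/32`, enough to control sine and cosine by their
Taylor bounds. -/
theorem tiltAngle_trig {x a : ℝ} (hx : 8 ≤ x) (ha : 0 ≤ a) (hax : a ^ 2 ≤ x)
    (hxa : x ≤ a ^ 2 + 1) :
    0 ≤ Real.sin (tiltAngle x) ∧ 4 / 5 ≤ Real.cos (tiltAngle x) ∧
      Real.sin (tiltAngle x) ≤ 3 / 5 ∧ Real.sin (tiltAngle x) * a ≤ 3 / 2 ∧
      6 / 5 ≤ Real.sin (tiltAngle x) * a := by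
  obtain ⟨h0, h1, h2⟩ := tiltAngle_bounds hx
  set α := tiltAngle x
  have hα : α ^ 2 ≤ 9 / 32 := by nlinarith [sq_nonneg α]
  have hα1 : α ≤ 3 / 5 := by nlinarith
  have hs : Real.sin α ≤ α := Real.sin_le h0.le
  have hs' := Real.sin_gt_sub_cube h0
  have hc := Real.one_sub_sq_div_two_le_cos (x := α)
  have hα2 : α * a ≤ 3 / 2 := by
    apply le_of_sq_le_sq _ (by norm_num)
    nlinarith [mul_le_mul_of_nonneg_left hax (sq_nonneg α)]
  -- Since `x ≥ 8`, `α² a² ≥ α² (x - 1) ≥ (7/9) α² (x + 1) ≥ 7/4`, and `33/25` is just below `√7 /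
  -- 2`.
  have hα3 : 33 / 25 ≤ α * a := by
    apply le_of_sq_le_sq _ (by positivity)
    nlinarith [mul_le_mul_of_nonneg_left hxa (sq_nonneg α)]
  -- `119/128 = 1 - (9/32) / 4`, from `sin α > α - α³ / 4`.
  have hsα : α * (119 / 128) ≤ Real.sin α := by nlinarith
  refine ⟨by nlinarith, by linarith, by linarith, ?_, ?_⟩
  · nlinarith
  · nlinarith [mul_le_mul_of_nonneg_right hsα ha]

/-- The tilt, written in the frame of `hadamard`. -/
def tiltTwist : (ℂ × ℂ) ≃ (ℂ × ℂ) :=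
  twist (fun x => deriv tiltAngle (x.1 + x.2) * (x.1 - x.2) + tiltAngle (x.1 + x.2))
    (fun x => deriv tiltAngle (x.1 + x.2) * (x.1 - x.2) - tiltAngle (x.1 + x.2))

/-- The two angles are the partial derivatives of `tiltAngle (s + t) * (s - t)`, hence closed. The
terms with `deriv tiltAngle` only contribute a common phase. -/
theorem tiltTwist_isSymplectomorphism : IsSymplectomorphism tiltTwist := by
  have hd : ContDiff ℝ ∞ (deriv tiltAngle) := (contDiff_infty_iff_deriv.1 contDiff_tiltAngle).2
  have hs : ContDiff ℝ ∞ fun x : ℝ × ℝ => x.1 + x.2 := contDiff_fst.add contDiff_snd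
  have hm : ContDiff ℝ ∞ fun x : ℝ × ℝ => x.1 - x.2 := contDiff_fst.sub contDiff_snd
  refine twist_isSymplectomorphism (((hd.comp hs).mul hm).add (contDiff_tiltAngle.comp hs))
    (((hd.comp hs).mul hm).sub (contDiff_tiltAngle.comp hs)) fun s t =>
      ⟨deriv (deriv tiltAngle) (s + t) * (s - t), ?_, ?_⟩
  · have h1 := (hd.differentiable (by simp) (s + t)).hasDerivAt.comp_const_add s t
    have h2 := (contDiff_tiltAngle.differentiable (by simp) (s + t)).hasDerivAt.comp_const_add s t
    exact ((h1.mul ((hasDerivAt_id t).const_sub s)).add h2).congr_deriv (by simp)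
  · have h1 := (hd.differentiable (by simp) (s + t)).hasDerivAt.comp_add_const s t
    have h2 := (contDiff_tiltAngle.differentiable (by simp) (s + t)).hasDerivAt.comp_add_const s t
    exact ((h1.mul ((hasDerivAt_id s).sub_const t)).sub h2).congr_deriv (by simp)

/-- The rotation of the second coordinate by a quarter turn. -/
def quarterTurn : (ℂ × ℂ) ≃ (ℂ × ℂ) := twist (fun _ => 0) (fun _ => -(Real.pi / 2))

theorem quarterTurn_apply (z : ℂ × ℂ) : quarterTurn z = (z.1, -Complex.I * z.2) := by
  rw [quarterTurn, twist_apply]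
  have : Complex.exp ((-(Real.pi / 2) : ℝ) * Complex.I) = -Complex.I := by
    push_cast
    rw [neg_mul, Complex.exp_neg, Complex.exp_pi_div_two_mul_I, Complex.inv_I]
  rw [this]; simp

theorem quarterTurn_isSymplectomorphism : IsSymplectomorphism quarterTurn :=
  twist_isSymplectomorphism contDiff_const contDiff_const fun _ _ =>
    ⟨0, hasDerivAt_const _ _, hasDerivAt_const _ _⟩

/-- The tilt: a rotation of `ℂ²` whose angle depends on the sphere, up to phases. -/
def tilt : (ℂ × ℂ) ≃ (ℂ × ℂ) := ((hadamard.trans tiltTwist).trans hadamard).trans quarterTurn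

theorem tilt_isSymplectomorphism : IsSymplectomorphism tilt :=
  ((hadamard_isSymplectomorphism.trans tiltTwist_isSymplectomorphism).trans
    hadamard_isSymplectomorphism).trans quarterTurn_isSymplectomorphism

theorem exp_add_exp_div_two (ψ α : ℝ) :
    (Complex.exp ((ψ + α : ℝ) * Complex.I) + Complex.exp ((ψ - α : ℝ) * Complex.I)) / 2 =
      Complex.exp (ψ * Complex.I) * Real.cos α := by
  apply Complex.ext <;>
  simp [Complex.mul_re, Complex.mul_im, Complex.exp_ofReal_mul_I_re, -Complex.ofReal_add,
    -Complex.ofReal_sub, -Complex.ofReal_cos,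
    Complex.exp_ofReal_mul_I_im, Real.cos_add, Real.cos_sub, Real.sin_add, Real.sin_sub]

theorem exp_sub_exp_div_two (ψ α : ℝ) :
    (Complex.exp ((ψ + α : ℝ) * Complex.I) - Complex.exp ((ψ - α : ℝ) * Complex.I)) / 2 =
      Complex.exp (ψ * Complex.I) * (Real.sin α * Complex.I) := by
  apply Complex.ext <;>
  simp [Complex.mul_re, Complex.mul_im, Complex.exp_ofReal_mul_I_re, -Complex.ofReal_add,
    -Complex.ofReal_sub, -Complex.ofReal_sin,
    Complex.exp_ofReal_mul_I_im, Real.cos_add, Real.cos_sub, Real.sin_add, Real.sin_sub]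
  all_goals ring

theorem hadamard_sq_norm_add (z : ℂ × ℂ) :
    ‖(hadamard z).1‖ ^ 2 + ‖(hadamard z).2‖ ^ 2 = ‖z.1‖ ^ 2 + ‖z.2‖ ^ 2 := by
  rw [hadamard_sq_norm_fst, hadamard_sq_norm_snd]; ring

theorem twist_sq_norm_add (f g : ℝ × ℝ → ℝ) (z : ℂ × ℂ) :
    ‖(twist f g z).1‖ ^ 2 + ‖(twist f g z).2‖ ^ 2 = ‖z.1‖ ^ 2 + ‖z.2‖ ^ 2 := by
  simp only [twist_apply, norm_exp_mul]

theorem tilt_sq_norm_add (z : ℂ × ℂ) :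
    ‖(tilt z).1‖ ^ 2 + ‖(tilt z).2‖ ^ 2 = ‖z.1‖ ^ 2 + ‖z.2‖ ^ 2 := by
  simp only [tilt, Equiv.trans_apply, quarterTurn, tiltTwist, twist_sq_norm_add,
    hadamard_sq_norm_add]

/-- The quarter turn removes a relative factor `I` between the coordinates; with it in place, the
leading term of `Re (w₁ conj w₂)` near an axis would vanish. -/
theorem tilt_apply (z : ℂ × ℂ) : ∃ ψ : ℝ,
    tilt z =
      (Complex.exp (ψ * Complex.I) * (Real.cos (tiltAngle (‖z.1‖ ^ 2 + ‖z.2‖ ^ 2)) * z.1 +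
        Real.sin (tiltAngle (‖z.1‖ ^ 2 + ‖z.2‖ ^ 2)) * (Complex.I * z.2)),
      Complex.exp (ψ * Complex.I) * (Real.sin (tiltAngle (‖z.1‖ ^ 2 + ‖z.2‖ ^ 2)) * z.1 -
        Real.cos (tiltAngle (‖z.1‖ ^ 2 + ‖z.2‖ ^ 2)) * (Complex.I * z.2))) := by
  set α := tiltAngle (‖z.1‖ ^ 2 + ‖z.2‖ ^ 2) with hα
  refine ⟨deriv tiltAngle (‖z.1‖ ^ 2 + ‖z.2‖ ^ 2) *
    (‖(hadamard z).1‖ ^ 2 - ‖(hadamard z).2‖ ^ 2), ?_⟩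
  simp only [tilt, Equiv.trans_apply, tiltTwist, twist_apply, sqNorms, hadamard_sq_norm_add, ← hα]
  rw [hadamard_diag_hadamard, exp_add_exp_div_two, exp_sub_exp_div_two, quarterTurn_apply]
  ext1
  · ring
  · linear_combination (-(Complex.exp (((deriv tiltAngle (‖z.1‖ ^ 2 + ‖z.2‖ ^ 2) *
      (‖(hadamard z).1‖ ^ 2 - ‖(hadamard z).2‖ ^ 2) : ℝ) : ℂ) * Complex.I) *
      Real.sin α * z.1)) * Complex.I_mul_I

theorem re_mul_conj_rotate (ψ : ℝ) (u v : ℂ) :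
    (Complex.exp (ψ * Complex.I) * u).re * (Complex.exp (ψ * Complex.I) * v).re +
      (Complex.exp (ψ * Complex.I) * u).im * (Complex.exp (ψ * Complex.I) * v).im =
    u.re * v.re + u.im * v.im := by
  simp only [Complex.mul_re, Complex.mul_im, Complex.exp_ofReal_mul_I_re,
    Complex.exp_ofReal_mul_I_im]
  linear_combination (u.re * v.re + u.im * v.im) * Real.sin_sq_add_cos_sq ψ

/-- The real part of `z₁ * conj z₂`. -/
def height (z : ℂ × ℂ) : ℝ := z.1.re * z.2.re + z.1.im * z.2.im

theorem tilt_height (z : ℂ × ℂ) :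
    height (tilt z) =
      Real.cos (tiltAngle (‖z.1‖ ^ 2 + ‖z.2‖ ^ 2)) * Real.sin (tiltAngle (‖z.1‖ ^ 2 + ‖z.2‖ ^ 2)) *
        (‖z.1‖ ^ 2 - ‖z.2‖ ^ 2) +
      (Real.cos (tiltAngle (‖z.1‖ ^ 2 + ‖z.2‖ ^ 2)) ^ 2 -
        Real.sin (tiltAngle (‖z.1‖ ^ 2 + ‖z.2‖ ^ 2)) ^ 2) *
        (z.1.re * z.2.im - z.1.im * z.2.re) := by
  obtain ⟨ψ, h⟩ := tilt_apply z
  rw [h, height, re_mul_conj_rotate]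
  generalize tiltAngle (‖z.1‖ ^ 2 + ‖z.2‖ ^ 2) = α
  simp only [sq_norm_eq, Complex.add_re, Complex.add_im, Complex.sub_re, Complex.sub_im,
    Complex.re_ofReal_mul, Complex.im_ofReal_mul, Complex.I_mul_re, Complex.I_mul_im]
  ring

theorem abs_area_le (z w : ℂ) : |z.re * w.im - z.im * w.re| ≤ ‖z‖ * ‖w‖ := by
  apply abs_le_of_sq_le_sq _ (by positivity)
  rw [mul_pow, sq_norm_eq, sq_norm_eq]
  nlinarith [sq_nonneg (z.re * w.re + z.im * w.im)]

theorem norm_ofReal_mul_of_nonneg {r : ℝ} (hr : 0 ≤ r) (w : ℂ) : ‖(r : ℂ) * w‖ = r * ‖w‖ := by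
  rw [norm_mul, Complex.norm_real, Real.norm_of_nonneg hr]

/-- With `|k|` replaced by its bound `a * t`, the expression factors as `(C a + S t) (S a - C t)`,
which is at least `8/5 * 1/5 > 1/4`. -/
theorem height_lower_bound {S C a t k : ℝ} (hS : 0 ≤ S) (hC : 4 / 5 ≤ C) (hC1 : C ≤ 1)
    (hS1 : S ≤ 3 / 5) (ha : 2 ≤ a) (ht : 0 ≤ t) (ht1 : t ≤ 1) (hSa : 6 / 5 ≤ S * a)
    (hk : |k| ≤ a * t) :
    1 / 4 ≤ C * S * (a ^ 2 - t ^ 2) - (C ^ 2 - S ^ 2) * |k| := by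
  have h1 : (C ^ 2 - S ^ 2) * |k| ≤ (C ^ 2 - S ^ 2) * (a * t) :=
    mul_le_mul_of_nonneg_left hk (by nlinarith)
  have h2 : 1 / 5 ≤ S * a - C * t := by nlinarith
  have h3 : 8 / 5 ≤ C * a + S * t := by nlinarith [mul_nonneg hS ht]
  nlinarith [mul_le_mul h3 h2 (by norm_num) (by linarith)]

/-- The bound `5/2` is the displacement `3/2` plus the thickness `1`. -/
theorem tilt_near_fst {z : ℂ × ℂ} (hz : ‖z.2‖ ≤ 1) (hN : 8 ≤ ‖z.1‖ ^ 2 + ‖z.2‖ ^ 2) :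
    1 / 4 ≤ height (tilt z) ∧ ‖(tilt z).2‖ ≤ 5 / 2 := by
  have h1 := norm_nonneg z.1
  have h2 := norm_nonneg z.2
  obtain ⟨hS, hC, hS1, hSa, hSa'⟩ := tiltAngle_trig hN h1 (by nlinarith) (by nlinarith)
  have hC1 := Real.cos_le_one (tiltAngle (‖z.1‖ ^ 2 + ‖z.2‖ ^ 2))
  constructor
  · rw [tilt_height]
    set α := tiltAngle (‖z.1‖ ^ 2 + ‖z.2‖ ^ 2)
    have := height_lower_bound hS hC hC1 hS1 (by nlinarith) h2 hz hSa' (abs_area_le z.1 z.2)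
    have hCS : 0 ≤ Real.cos α ^ 2 - Real.sin α ^ 2 := by nlinarith
    linarith [mul_le_mul_of_nonneg_left (neg_abs_le (z.1.re * z.2.im - z.1.im * z.2.re)) hCS]
  · obtain ⟨ψ, h⟩ := tilt_apply z
    rw [h]
    set α := tiltAngle (‖z.1‖ ^ 2 + ‖z.2‖ ^ 2)
    rw [norm_exp_mul]
    refine (norm_sub_le _ _).trans ?_
    rw [norm_ofReal_mul_of_nonneg hS, norm_ofReal_mul_of_nonneg (by linarith), norm_mul,
      Complex.norm_I, one_mul]
    nlinarith

theorem tilt_near_snd {z : ℂ × ℂ} (hz : ‖z.1‖ ≤ 1) (hN : 8 ≤ ‖z.1‖ ^ 2 + ‖z.2‖ ^ 2) :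
    height (tilt z) ≤ -(1 / 4) ∧ ‖(tilt z).1‖ ≤ 5 / 2 := by
  have h1 := norm_nonneg z.1
  have h2 := norm_nonneg z.2
  obtain ⟨hS, hC, hS1, hSa, hSa'⟩ := tiltAngle_trig hN h2 (by nlinarith) (by nlinarith)
  have hC1 := Real.cos_le_one (tiltAngle (‖z.1‖ ^ 2 + ‖z.2‖ ^ 2))
  constructor
  · rw [tilt_height]
    set α := tiltAngle (‖z.1‖ ^ 2 + ‖z.2‖ ^ 2)
    have := height_lower_bound hS hC hC1 hS1 (by nlinarith) h1 hz hSa'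
      ((abs_area_le z.1 z.2).trans_eq (mul_comm _ _))
    have hCS : 0 ≤ Real.cos α ^ 2 - Real.sin α ^ 2 := by nlinarith
    linarith [mul_le_mul_of_nonneg_left (le_abs_self (z.1.re * z.2.im - z.1.im * z.2.re)) hCS]
  · obtain ⟨ψ, h⟩ := tilt_apply z
    rw [h]
    set α := tiltAngle (‖z.1‖ ^ 2 + ‖z.2‖ ^ 2)
    rw [norm_exp_mul]
    refine (norm_add_le _ _).trans ?_
    rw [norm_ofReal_mul_of_nonneg hS, norm_ofReal_mul_of_nonneg (by linarith), norm_mul,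
      Complex.norm_I, one_mul]
    nlinarith

/-! ### Swapping the coordinates on one side -/

/-- The angle of `partialSwap`, as a function of twice the height. -/
def swapAngle (x : ℝ) : ℝ := Real.pi / 2 * Real.smoothTransition (1 / 2 - x)

theorem contDiff_swapAngle : ContDiff ℝ ∞ swapAngle :=
  contDiff_const.mul (Real.smoothTransition.contDiff.comp (contDiff_const.sub contDiff_id))

/-- The partial swap, written in the frame of `hadamard`. -/
def swapTwist : (ℂ × ℂ) ≃ (ℂ × ℂ) :=
  twist (fun x => swapAngle (x.1 - x.2)) (fun x => -swapAngle (x.1 - x.2))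

theorem swapTwist_isSymplectomorphism : IsSymplectomorphism swapTwist := by
  have h : ContDiff ℝ ∞ fun x : ℝ × ℝ => swapAngle (x.1 - x.2) :=
    contDiff_swapAngle.comp (contDiff_fst.sub contDiff_snd)
  refine twist_isSymplectomorphism h h.neg fun s t => ⟨-deriv swapAngle (s - t), ?_, ?_⟩
  · exact (contDiff_swapAngle.differentiable (by simp) (s - t)).hasDerivAt.comp_const_sub s t
  · exact ((contDiff_swapAngle.differentiable (by simp) (s - t)).hasDerivAt.comp_sub_const s t).neg

/-- A unitary map on each level set of the height: the identity where the height is at least `1/4`,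
the swap of the coordinates, up to phase, where it is at most `-1/4`. -/
def partialSwap : (ℂ × ℂ) ≃ (ℂ × ℂ) := (hadamard.trans swapTwist).trans hadamard

theorem partialSwap_isSymplectomorphism : IsSymplectomorphism partialSwap :=
  (hadamard_isSymplectomorphism.trans swapTwist_isSymplectomorphism).trans
    hadamard_isSymplectomorphism

theorem partialSwap_sq_norm_add (z : ℂ × ℂ) :
    ‖(partialSwap z).1‖ ^ 2 + ‖(partialSwap z).2‖ ^ 2 = ‖z.1‖ ^ 2 + ‖z.2‖ ^ 2 := by
  simp only [partialSwap, Equiv.trans_apply, swapTwist, twist_sq_norm_add, hadamard_sq_norm_add]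

theorem partialSwap_apply (z : ℂ × ℂ) :
    partialSwap z =
      (Real.cos (swapAngle (2 * height z)) * z.1 +
        Real.sin (swapAngle (2 * height z)) * (Complex.I * z.2),
      Real.sin (swapAngle (2 * height z)) * (Complex.I * z.1) +
        Real.cos (swapAngle (2 * height z)) * z.2) := by
  have h : ‖(hadamard z).1‖ ^ 2 - ‖(hadamard z).2‖ ^ 2 = 2 * height z := by
    rw [hadamard_sq_norm_fst, hadamard_sq_norm_snd, height]; ring
  have hc := exp_add_exp_div_two 0 (swapAngle (2 * height z))
  have hs := exp_sub_exp_div_two 0 (swapAngle (2 * height z))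
  rw [zero_add, zero_sub, Complex.ofReal_zero, zero_mul, Complex.exp_zero, one_mul] at hc hs
  simp only [partialSwap, Equiv.trans_apply, swapTwist, twist_apply, sqNorms, h]
  rw [hadamard_diag_hadamard, hc, hs]
  ext1 <;> ring

theorem partialSwap_of_le_height {z : ℂ × ℂ} (hz : 1 / 4 ≤ height z) : partialSwap z = z := by
  have : swapAngle (2 * height z) = 0 := by
    rw [swapAngle, Real.smoothTransition.zero_of_nonpos (by linarith), mul_zero]
  simp [partialSwap_apply, this]

theorem partialSwap_of_height_le {z : ℂ × ℂ} (hz : height z ≤ -(1 / 4)) :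
    partialSwap z = (Complex.I * z.2, Complex.I * z.1) := by
  have : swapAngle (2 * height z) = Real.pi / 2 := by
    rw [swapAngle, Real.smoothTransition.one_of_one_le (by linarith), mul_one]
  simp [partialSwap_apply, this, -Complex.ofReal_div]

/-! ### The embedding -/

/-- The standard ellipsoid `{c |z₁|² + |z₂|² ≤ r}`. -/
def slab (c r : ℝ) : Set (ℂ × ℂ) := {z | c * ‖z.1‖ ^ 2 + ‖z.2‖ ^ 2 ≤ r}

theorem partialSwap_tilt_mem_slab {c : ℝ} (hc : 0 < c) (hc1 : c ≤ 1) {z : ℂ × ℂ}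
    (hz : c * ‖z.1‖ ^ 2 + ‖z.2‖ ^ 2 ≤ 1 ∨ ‖z.1‖ ^ 2 + c * ‖z.2‖ ^ 2 ≤ 1) :
    partialSwap (tilt z) ∈ slab c 9 := by
  set w := partialSwap (tilt z) with hw
  have hN : ‖w.1‖ ^ 2 + ‖w.2‖ ^ 2 = ‖z.1‖ ^ 2 + ‖z.2‖ ^ 2 := by
    rw [hw, partialSwap_sq_norm_add, tilt_sq_norm_add]
  have hcN : c * (‖z.1‖ ^ 2 + ‖z.2‖ ^ 2) ≤ 1 := by
    rcases hz with h | h <;> nlinarith [sq_nonneg ‖z.1‖, sq_nonneg ‖z.2‖]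
  have hcw : c * ‖w.1‖ ^ 2 ≤ 1 := by nlinarith [sq_nonneg ‖w.2‖]
  -- Inside the ball `|z|² ≤ 8` this is conservation of `|z|²`, so the behaviour of the maps near
  -- the crossing of the axes is irrelevant; outside, `(5/2)² < 8`.
  have key : ‖w.2‖ ^ 2 ≤ 8 := by
    rcases le_total 8 (‖z.1‖ ^ 2 + ‖z.2‖ ^ 2) with h8 | h8
    · have : ‖w.2‖ ≤ 5 / 2 := by
        rcases hz with h | h
        · obtain ⟨h1, h2⟩ := tilt_near_fst
            (by nlinarith [mul_nonneg hc.le (sq_nonneg ‖z.1‖)]) h8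
          rwa [hw, partialSwap_of_le_height h1]
        · obtain ⟨h1, h2⟩ := tilt_near_snd
            (by nlinarith [mul_nonneg hc.le (sq_nonneg ‖z.2‖)]) h8
          rw [hw, partialSwap_of_height_le h1]
          simpa using h2
      nlinarith [norm_nonneg w.2]
    · nlinarith [sq_nonneg ‖w.1‖]
  show c * ‖w.1‖ ^ 2 + ‖w.2‖ ^ 2 ≤ 9
  linarith

/-! ### The toric domain and the ellipsoid -/

/-- The ratio of the axes of the ellipsoid one half of the toric domain lies in. -/
def axisRatio (m : ℝ) : ℝ := m / (1 - m)

/-- The ellipsoid `{π |z₁|² / 3 + π |z₂|² / (3 c) ≤ 1}`. -/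
def ellipsoid (c : ℝ) : Set (ℂ × ℂ) :=
  {z | c * (Real.pi * ‖z.1‖ ^ 2) + Real.pi * ‖z.2‖ ^ 2 ≤ 3 * c}

theorem isConvexDomain_ellipsoid {c : ℝ} (hc : 0 < c) : IsConvexDomain (ellipsoid c) := by
  have hπ := Real.pi_pos
  have hcont : Continuous fun z : ℂ × ℂ => c * (Real.pi * ‖z.1‖ ^ 2) + Real.pi * ‖z.2‖ ^ 2 := by
    fun_prop
  refine ⟨?_, ?_, ⟨0, ?_⟩⟩
  · have hn : ConvexOn ℝ Set.univ fun w : ℂ => ‖w‖ ^ 2 :=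
      (convexOn_norm convex_univ).pow (fun _ _ => norm_nonneg _) 2
    have h1 := ((hn.comp_linearMap (LinearMap.fst ℝ ℂ ℂ)).smul hπ.le).smul hc.le
    have h2 := (hn.comp_linearMap (LinearMap.snd ℝ ℂ ℂ)).smul hπ.le
    have := (h1.add h2).convex_le (3 * c)
    simpa [ellipsoid] using this
  · refine Metric.isCompact_of_isClosed_isBounded (isClosed_le hcont continuous_const) ?_
    refine (Metric.isBounded_closedBall (x := (0 : ℂ × ℂ)) (r := √(3 + 3 * c))).subset ?_
    intro z hz
    have hz' : c * (Real.pi * ‖z.1‖ ^ 2) + Real.pi * ‖z.2‖ ^ 2 ≤ 3 * c := hz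
    have h3 := Real.pi_gt_three
    rw [mem_closedBall_zero_iff, Prod.norm_def, max_le_iff]
    constructor <;> apply Real.le_sqrt_of_sq_le
    · have : c * (Real.pi * ‖z.1‖ ^ 2) ≤ c * 3 := by nlinarith [sq_nonneg ‖z.2‖]
      have := le_of_mul_le_mul_left this hc
      nlinarith [sq_nonneg ‖z.1‖]
    · have : 0 ≤ c * (Real.pi * ‖z.1‖ ^ 2) := by positivity
      nlinarith [sq_nonneg ‖z.2‖]
  · refine interior_mono (s := {z : ℂ × ℂ |
      c * (Real.pi * ‖z.1‖ ^ 2) + Real.pi * ‖z.2‖ ^ 2 < 3 * c}) (Set.ofPred_subset_ofPred.2 fun z hz => le_of_lt hz) ?_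
    rw [(isOpen_lt hcont continuous_const).interior_eq]
    simpa using hc

theorem diagCoord_pos (p : ℝ) : 0 < diagCoord p := Real.rpow_pos_of_pos (by norm_num) _

theorem diagCoord_le_half {p : ℝ} (hp0 : 0 < p) (hp1 : p ≤ 1) : diagCoord p ≤ 1 / 2 := by
  have h : (2 : ℝ) ^ (-(1 / p)) ≤ (2 : ℝ) ^ (-1 : ℝ) :=
    Real.rpow_le_rpow_of_exponent_le (by norm_num) (by
      rw [neg_le_neg_iff, le_div_iff₀ hp0]; linarith)
  rw [Real.rpow_neg_one] at h
  rw [diagCoord]; linarith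

theorem axisRatio_pos {m : ℝ} (hm0 : 0 < m) (hm : m ≤ 1 / 2) : 0 < axisRatio m :=
  div_pos hm0 (by linarith)

theorem axisRatio_le_one {m : ℝ} (hm : m ≤ 1 / 2) : axisRatio m ≤ 1 :=
  (div_le_one (by linarith)).2 (by linarith)

theorem linearRegion_subset {p : ℝ} (hp0 : 0 < p) (hp1 : p ≤ 1) {x : ℝ × ℝ}
    (hx : x ∈ linearRegion p) :
    axisRatio (diagCoord p) * x.1 + x.2 ≤ axisRatio (diagCoord p) ∨
      x.1 + axisRatio (diagCoord p) * x.2 ≤ axisRatio (diagCoord p) := by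
  have hm0 := diagCoord_pos p
  have hm := diagCoord_le_half hp0 hp1
  set m := diagCoord p
  have hc0 := axisRatio_pos hm0 hm
  have hcm : axisRatio m * m + m = axisRatio m := by
    have : (1 - m) ≠ 0 := by linarith
    rw [axisRatio]; field_simp; ring
  have half (L : (ℝ × ℝ) →ₗ[ℝ] ℝ) : Convex ℝ {x | L x ≤ axisRatio m} :=
    convex_halfSpace_le L.isLinear _
  rcases hx with hx | hx
  · left
    refine convexHull_min ?_ (half (axisRatio m • LinearMap.fst ℝ ℝ ℝ + LinearMap.snd ℝ ℝ ℝ)) hx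
    rintro y (rfl | rfl | rfl) <;> simp [hc0.le]
    exact hcm.le
  · right
    refine convexHull_min ?_ (half (LinearMap.fst ℝ ℝ ℝ + axisRatio m • LinearMap.snd ℝ ℝ ℝ)) hx
    rintro y (rfl | rfl | rfl) <;> simp [hc0.le]
    linarith

theorem mem_convexHull_of_combination {E : Type*} [AddCommGroup E] [Module ℝ E] {u v x : E}
    {a b : ℝ} (ha : 0 ≤ a) (hb : 0 ≤ b) (hab : a + b ≤ 1) (hx : a • u + b • v = x) :
    x ∈ convexHull ℝ {0, u, v} := by
  have h := (convex_convexHull ℝ {0, u, v}).sum_mem (t := Finset.univ) (w := ![1 - a - b, a, b])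
    (z := ![0, u, v]) ?_ ?_ ?_
  · simpa [Fin.sum_univ_three, hx] using h
  · intro i _
    fin_cases i <;> simp [ha, hb]
    linarith
  · simp only [Fin.sum_univ_three, Matrix.cons_val]
    ring
  · intro i _
    apply subset_convexHull
    fin_cases i <;> simp

/-- Above the diagonal the line `c x + y = c` stays below the broken line because `m ≤ 1/2`; below
the diagonal they coincide. -/
theorem subset_linearRegion {p : ℝ} (hp0 : 0 < p) (hp1 : p ≤ 1) {x : ℝ × ℝ}
    (h1 : 0 ≤ x.1) (h2 : 0 ≤ x.2)
    (hx : axisRatio (diagCoord p) * x.1 + x.2 ≤ axisRatio (diagCoord p)) :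
    x ∈ linearRegion p := by
  have hm0 := diagCoord_pos p
  have hm := diagCoord_le_half hp0 hp1
  unfold linearRegion
  set m := diagCoord p
  have hx' : m * x.1 + (1 - m) * x.2 ≤ m := by
    have h : 0 < 1 - m := by linarith
    have hc : (1 - m) * axisRatio m = m := by rw [axisRatio]; field_simp
    have := mul_le_mul_of_nonneg_left hx h.le
    nlinarith
  rcases le_total x.2 x.1 with h | h
  · left
    refine mem_convexHull_of_combination (a := x.1 - x.2) (b := x.2 / m) (by linarith)
      (by positivity) ?_ ?_
    · have : x.2 / m ≤ 1 - (x.1 - x.2) := by rw [div_le_iff₀ hm0]; nlinarith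
      linarith
    · ext <;> simp <;> field_simp
      ring
  · right
    refine mem_convexHull_of_combination (a := x.2 - x.1) (b := x.1 / m) (by linarith)
      (by positivity) ?_ ?_
    · have : x.1 / m ≤ 1 - (x.2 - x.1) := by
        rw [div_le_iff₀ hm0]; nlinarith [mul_nonneg (sub_nonneg.2 h) (by linarith : 0 ≤ 1 - 2 * m)]
      linarith
    · ext <;> simp <;> field_simp
      ring

theorem momentMap_smul (r : ℝ) (z : ℂ × ℂ) : momentMap (r • z) = r ^ 2 • momentMap z := by
  ext <;> simp [momentMap, mul_pow] <;> ring

theorem ellipsoid_subset_smul_toricDomain {p : ℝ} (hp0 : 0 < p) (hp1 : p ≤ 1) :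
    ellipsoid (axisRatio (diagCoord p)) ⊆ √3 • toricDomain (linearRegion p) := by
  intro z hz
  have h3 : (√3 : ℝ) ≠ 0 := by positivity
  rw [Set.mem_smul_set_iff_inv_smul_mem₀ h3, toricDomain, Set.mem_preimage, momentMap_smul,
    inv_pow, Real.sq_sqrt (by norm_num)]
  rw [ellipsoid, Set.mem_ofPred_eq] at hz
  apply subset_linearRegion hp0 hp1 <;> simp only [momentMap, Prod.smul_fst, Prod.smul_snd,
    smul_eq_mul]
  · positivity
  · positivity
  · linarith

theorem smul_toricDomain_embeds {p : ℝ} (hp0 : 0 < p) (hp1 : p ≤ 1) :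
    SymplEmbeds ((√3)⁻¹ • toricDomain (linearRegion p)) (ellipsoid (axisRatio (diagCoord p))) := by
  have hc := axisRatio_pos (diagCoord_pos p) (diagCoord_le_half hp0 hp1)
  have hc1 := axisRatio_le_one (diagCoord_le_half hp0 hp1)
  set c := axisRatio (diagCoord p) with hcdef
  have hπ := Real.pi_pos
  -- Chosen so that a point of `(√3)⁻¹ X` scaled by `r` has `c |r z|² / 3 = π |z|²`, which turns the
  -- two ellipsoids containing `X` into the normalised ones with right-hand side `1`.
  set r := √(3 * Real.pi / c) with hr
  have hr2 : r ^ 2 = 3 * Real.pi / c := Real.sq_sqrt (by positivity)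
  have hr0 : r ≠ 0 := by positivity
  refine ⟨conjHomothety r hr0 (tilt.trans partialSwap),
    (tilt_isSymplectomorphism.trans partialSwap_isSymplectomorphism).conjHomothety hr0, ?_⟩
  rintro _ ⟨_, ⟨z, hz, rfl⟩, rfl⟩
  have hrr : c * r ^ 2 = 3 * Real.pi := by rw [hr2]; field_simp
  have hs : ((√3)⁻¹) ^ 2 = (1 / 3 : ℝ) := by rw [inv_pow, Real.sq_sqrt (by norm_num)]; norm_num
  have hmem : partialSwap (tilt (r • (√3)⁻¹ • z)) ∈ slab c 9 := by
    apply partialSwap_tilt_mem_slab hc hc1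
    have e : ∀ w : ℂ, c * ‖r • (√3)⁻¹ • w‖ ^ 2 = Real.pi * ‖w‖ ^ 2 := by
      intro w
      rw [norm_smul, norm_smul, mul_pow, mul_pow, Real.norm_eq_abs, Real.norm_eq_abs, sq_abs,
        sq_abs, hs]
      linear_combination (1 / 3 * ‖w‖ ^ 2) * hrr
    have e1 := e z.1
    have e2 := e z.2
    simp only [Prod.smul_fst, Prod.smul_snd]
    rcases linearRegion_subset hp0 hp1 hz with h | h <;>
      simp only [momentMap, ← hcdef] at h
    · left
      refine le_of_mul_le_mul_left ?_ hc
      linarith [e1 ▸ h]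
    · right
      refine le_of_mul_le_mul_left ?_ hc
      linarith [e2 ▸ h]
  set w := partialSwap (tilt (r • (√3)⁻¹ • z))
  show r⁻¹ • w ∈ ellipsoid c
  have hw : c * ‖w.1‖ ^ 2 + ‖w.2‖ ^ 2 ≤ 9 := hmem
  have e : ∀ u : ℂ, Real.pi * ‖r⁻¹ • u‖ ^ 2 = c / 3 * ‖u‖ ^ 2 := by
    intro u
    rw [norm_smul, mul_pow, norm_inv, Real.norm_eq_abs, inv_pow, sq_abs, hr2]
    field_simp
  show c * (Real.pi * ‖r⁻¹ • w.1‖ ^ 2) + Real.pi * ‖r⁻¹ • w.2‖ ^ 2 ≤ 3 * c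
  rw [e, e]
  nlinarith

end CoarseToric

end

theorem proposition3p1 (p : ℝ) (hp0 : 0 < p) (hp1 : p ≤ 1) :
    CoarseToric.coarseDistTo (CoarseToric.toricDomain (CoarseToric.linearRegion p))
      CoarseToric.symplConvexDomains ≤ ((1 / 2 * Real.log 3 : ℝ) : EReal) := by
  have hc := CoarseToric.axisRatio_pos (CoarseToric.diagCoord_pos p)
    (CoarseToric.diagCoord_le_half hp0 hp1)
  refine iInf₂_le_of_le (CoarseToric.ellipsoid (CoarseToric.axisRatio (CoarseToric.diagCoord p)))
    ⟨_, CoarseToric.isConvexDomain_ellipsoid hc, Equiv.refl _,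
      CoarseToric.IsSymplectomorphism.refl, by simp⟩ (sInf_le ⟨√3, ?_,
      CoarseToric.smul_toricDomain_embeds hp0 hp1, ⟨Equiv.refl _,
      CoarseToric.IsSymplectomorphism.refl, ?_⟩, ?_⟩)
  · exact Real.one_le_sqrt.2 (by norm_num)
  · simpa using CoarseToric.ellipsoid_subset_smul_toricDomain hp0 hp1
  · rw [Real.log_sqrt (by norm_num)]
    congr 1
    ring
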